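/- Let $H=(h_{ji})_{j\in J,\,i\in I}$ be a parity-check matrix over $\mathbb F_2$ with finite index sets $J$ (checks) and $I=\{1,\dots,n\}$ (bits), defining the binary code $C=\{x\in\mathbb F_2^n : Hx=0\}$. Its Tanner graph $T$ is the bipartite graph on $I\sqcup J$ in which the bit node $i$ and the check node $j$ are adjacent iff $h_{ji}=1$. Assume that $C$ is a cycle code, i.e. every bit node has degree $2$ in $T$. The normal graph $N=N(H)$ has vertex set $J$ and edges $e_1,\dots,e_n$, where $e_i$ joins the two checks adjacent to bit $i$ (parallel edges may occur). A cycle in $N$ is a nonempty sequence $\Gamma=(e_{i_1},\dots,e_{i_k})$ of edges, each with a direction, such that each edge ends where the next one begins and the last one ends where the first one begins. It is backtrackless if $e_{i_s}\ne e_{i_{s+1}}$ for all $1\le s<k$, tailless if $e_{i_1}\ne e_{i_k}$, and primitive if it is not the $r$-fold repetition of a cycle for any $r\ge 2$. Two cycles are equivalent if they differ by a cyclic shift. Put $g(\Gamma)=u_{i_1}\cdots u_{i_k}$. Hashimoto's edge zeta function of $N$ is $$\zeta_N(u_1,\dots,u_n)=\prod_{[\Gamma]}\bigl(1-g(\Gamma)\bigr)^{-1}\in\mathbb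 Z[[u_1,\dots,u_n]],$$ the product running over the equivalence classes of backtrackless, tailless, primitive cycles in $N$. For a positive integer $M$, an $M$-cover of $T$ is a graph $\widetilde T$ with a surjective graph homomorphism $\pi:\widetilde T\to T$ that maps the neighbourhood of each vertex $y$ bijectively onto the neighbourhood of $\pi(y)$ and whose fibres all have exactly $M$ elements. A codeword of $\widetilde T$ is an assignment $\tilde c$ of values in $\mathbb F_2$ to the vertices over bit nodes such that for each vertex over a check node the values at its neighbours sum to $0$. Its pseudo-codeword is $\omega(\tilde c)\in\mathbb Q^n$ with $\omega_i(\tilde c)=\frac1M\sum_{b\in\pi^{-1}(i)}\tilde c_b$ (values $0,1$ summed in $\mathbb Q$), and $M\cdot\omega(\tilde c)$ is called an unscaled pseudo-codeword of $C$. Theorem. The infinite product defining $\zeta_N$ converges coefficientwise (unconditionally), and for every $(p_1,\dots,p_n)\in\mathbb Z_{\ge0}^n$ the monomial $u_1^{p_1}\cdots u_n^{p_n}$ has nonzero coefficient in $\zeta_N$ if and only if $(p_1,\dots,p_n)$ is an unscaled pseudo-codeword of $C$, that is, equals $M\cdot\omega(\tilde c)$ for some $M\ge1$, some $M$-cover of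 $T$ and some codeword $\tilde c$ of that cover. -/

import Mathlib

open scoped MvPowerSeries.WithPiTopology

namespace CycleCode

/-! ### Binary codes, Tanner graphs, cycle codes -/

/-- The binary linear code with parity-check matrix `H` (rows = checks, columns = bits). -/
def binaryCode {J I : Type*} [Fintype I] (H : Matrix J I (ZMod 2)) :
    Submodule (ZMod 2) (I → ZMod 2) :=
  LinearMap.ker H.mulVecLin

/-- The Tanner graph of `H`: bit nodes `Sum.inl i`, check nodes `Sum.inr j`, and an edge
between them exactly when `H j i = 1`. -/
def tannerGraph {J I : Type*} (H : Matrix J I (ZMod 2)) : SimpleGraph (I ⊕ J) where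
  Adj a b := (∃ i j, a = Sum.inl i ∧ b = Sum.inr j ∧ H j i = 1) ∨
    (∃ i j, a = Sum.inr j ∧ b = Sum.inl i ∧ H j i = 1)
  symm := ⟨by
    rintro a b (⟨i, j, h⟩ | ⟨i, j, h⟩)
    · exact Or.inr ⟨i, j, h.2.1, h.1, h.2.2⟩
    · exact Or.inl ⟨i, j, h.2.1, h.1, h.2.2⟩⟩
  loopless := ⟨by
    rintro a (⟨i, j, h, h', -⟩ | ⟨i, j, h, h', -⟩) <;> simp [h] at h'⟩

/-- `H` defines a cycle code: every bit node of the Tanner graph has degree two. -/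
def IsCycleCode {J I : Type*} (H : Matrix J I (ZMod 2)) : Prop :=
  ∀ i : I, ((tannerGraph H).neighborSet (Sum.inl i)).ncard = 2

/-! ### Covers and pseudo-codewords -/

/-- A graph homomorphism `π : Y → X` is an (unramified) `M`-cover: it is surjective, it maps the
neighbourhood of each vertex `y` bijectively onto the neighbourhood of `π y`, and each fibre has
exactly `M` elements. -/
structure IsMCover {V W : Type*} {X : SimpleGraph V} {Y : SimpleGraph W} (π : Y →g X) (M : ℕ) :
    Prop where
  surjective : Function.Surjective π
  bijOn_neighborSet : ∀ y : W, Set.BijOn π (Y.neighborSet y) (X.neighborSet (π y))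
  ncard_fiber : ∀ x : V, (π ⁻¹' {x}).ncard = M

section Cover

variable {J I : Type*} {H : Matrix J I (ZMod 2)} {W : Type*} {Y : SimpleGraph W}

/-- The bit nodes of a cover of a Tanner graph: the vertices lying over bit nodes. -/
abbrev BitNode (π : Y →g tannerGraph H) : Type _ := {w : W // (π w).isLeft = true}

/-- The check nodes of a cover of a Tanner graph: the vertices lying over check nodes. -/
abbrev CheckNode (π : Y →g tannerGraph H) : Type _ := {w : W // (π w).isRight = true}

open Classical in
/-- The parity-check matrix described by a cover of a Tanner graph. -/
noncomputable def coverMatrix (π : Y →g tannerGraph H) :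
    Matrix (CheckNode π) (BitNode π) (ZMod 2) :=
  fun w b => if Y.Adj w b then 1 else 0

open Classical in
/-- The pseudo-codeword `ω(c)` of a configuration `c` of an `M`-cover: `ω_i(c)` is `1 / M` times
the sum, in `ℚ`, of the values in `{0, 1}` of `c` on the copies of the bit node `i`. -/
noncomputable def pseudoCodeword [Fintype W] (π : Y →g tannerGraph H) (M : ℕ)
    (c : BitNode π → ZMod 2) : I → ℚ :=
  fun i => (1 / (M : ℚ)) * ∑ b ∈ (Finset.univ : Finset (BitNode π)).filter (fun b => π b.1 = Sum.inl i),
    ((c b).val : ℚ)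

end Cover

/-- `x` is an unscaled pseudo-codeword: `x = M • ω(c)` for some positive `M`, some `M`-cover of the
Tanner graph and some codeword `c` of the code described by that cover. (Such covers are finite
when the Tanner graph is, so covers with vertex type in `Type` are all covers up to
isomorphism.) -/
def IsUnscaledPseudoCodeword {J I : Type*} (H : Matrix J I (ZMod 2)) (x : I → ℚ) : Prop :=
  ∃ (M : ℕ) (W : Type) (_ : Fintype W) (Y : SimpleGraph W) (π : Y →g tannerGraph H),
    0 < M ∧ IsMCover π M ∧
      ∃ c ∈ binaryCode (coverMatrix π), x = (M : ℚ) • pseudoCodeword π M c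

/-! ### The normal graph -/

/-- The normal graph: its vertices are the checks, and each bit `i` of degree two is an edge
joining the two checks that involve it. -/
def normalGraph {J I : Type*} (H : Matrix J I (ZMod 2)) : Graph J I where
  vertexSet := Set.univ
  IsLink i x y := x ≠ y ∧ {j | H j i = 1} = {x, y}
  isLink_symm := fun _ _ => ⟨fun x y h => ⟨h.1.symm, h.2.trans (Set.pair_comm x y)⟩⟩
  eq_or_eq_of_isLink_of_isLink := by
    intro e x y v w h h'
    have hx : x ∈ ({v, w} : Set J) := by
      rw [← h'.2, h.2]
      exact Set.mem_insert x {y}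
    simpa using hx
  left_mem_of_isLink := fun _ _ _ _ => Set.mem_univ _

/-! ### The edge zeta function of a loopless graph -/

section Zeta

variable {V E : Type*} (G : Graph V E)

/-- An edge of `G` together with one of its two directions. -/
structure DirectedEdge where
  source : V
  edge : E
  target : V
  isLink : G.IsLink edge source target

variable {G}

/-- A nonempty sequence of directed edges is a cycle if each one terminates where the next one
begins and the last one terminates where the first one begins. -/
def IsCycle (Γ : List (DirectedEdge G)) : Prop :=
  Γ.IsChain (fun d d' => d.target = d'.source) ∧
    ∃ h : Γ ≠ [], (Γ.getLast h).target = (Γ.head h).source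

/-- No edge is followed by itself (in either direction). -/
def IsBacktrackless (Γ : List (DirectedEdge G)) : Prop :=
  Γ.IsChain (fun d d' => d.edge ≠ d'.edge)

/-- The first edge and the last edge are different. -/
def IsTailless (Γ : List (DirectedEdge G)) : Prop :=
  ∀ h : Γ ≠ [], (Γ.head h).edge ≠ (Γ.getLast h).edge

/-- `Γ` is not obtained by following some cycle `r ≥ 2` times. -/
def IsPrimitive (Γ : List (DirectedEdge G)) : Prop :=
  ¬ ∃ (Θ : List (DirectedEdge G)) (r : ℕ),
    IsCycle Θ ∧ 2 ≤ r ∧ Γ = (List.replicate r Θ).flatten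

variable (G)

/-- The set `A(G)` of equivalence classes of backtrackless, tailless, primitive cycles.
Two cycles are equivalent if they differ by a cyclic shift; `Cycle` is the type of lists up
to cyclic shifts. -/
def primeCycles : Set (Cycle (DirectedEdge G)) :=
  {γ | ∃ Γ : List (DirectedEdge G), (Γ : Cycle (DirectedEdge G)) = γ ∧
    IsCycle Γ ∧ IsBacktrackless Γ ∧ IsTailless Γ ∧ IsPrimitive Γ}

variable {G}

/-- The monomial `g(Γ)`, the product of the indeterminates of the edges of `Γ`. -/
noncomputable def cycleMonomial (γ : Cycle (DirectedEdge G)) : MvPowerSeries E ℤ :=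
  (γ.toMultiset.map fun d => MvPowerSeries.X d.edge).prod

/-- The factor `(1 - g(Γ))⁻¹`. -/
noncomputable def eulerFactor (γ : Cycle (DirectedEdge G)) : MvPowerSeries E ℤ :=
  MvPowerSeries.invOfUnit (1 - cycleMonomial γ) 1

variable (G)

/-- The edge zeta function, the infinite product of the factors `(1 - g(Γ))⁻¹` over `A(G)`, taken
with respect to coefficientwise convergence in `ℤ⟦u_e : e ∈ E⟧`. -/
noncomputable def edgeZeta : MvPowerSeries E ℤ :=
  ∏' γ : primeCycles G, eulerFactor (γ : Cycle (DirectedEdge G))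

end Zeta

end CycleCode

/-! Both sides of the equivalence are shown to be the condition `IsBalanced`: at every check the
entries have an even sum and none exceeds the sum of the others.

The zeta function is a product of geometric series in nontrivial monomials. All coefficients are
nonnegative, so nothing cancels, and the exponents that occur form the additive monoid generated by
the exponents of the prime cycles (`coeff_tprod_geomSeries_ne_zero_iff`). Cycle exponents are
balanced because every passage through a check uses two different edges (`isBalanced_edgeCount`).
Pseudo-codewords are balanced because every copy of a check sees each neighbouring bit once, with
value 0 or 1 and even total (`IsMCover.isBalanced`).

Conversely, let `p` be balanced and take `p i` copies of each bit `i`. At each check the copies of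
the adjacent bits can be paired so that partners come from different bits (`exists_pairing`). This
pairing is used twice. Joining partners at every check turns the copies into closed backtrackless
walks in the normal graph, hence into powers of prime cycles (`IsBalanced.mem_primeExponents`).
Attaching both partners to the same copy of the check defines a cover with a codeword in which every
check copy sees no ones or exactly two (`IsBalanced.isUnscaledPseudoCodeword`). -/

namespace CycleCode

/-! ### Products of geometric series of monomials -/

section GeometricProducts

open MvPowerSeries

variable {σ ι : Type*}

/-- The geometric series `(1 - u^w)⁻¹`. -/
noncomputable def geomSeries (w : σ →₀ ℕ) : MvPowerSeries σ ℤ :=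
  invOfUnit (1 - monomial w 1) 1

/-- Since `w ≠ 0`, the series `1 - u^w` has constant term 1 and is inverted by `geomSeries w`.
Coefficients are computed from this recursion rather than from a closed formula. -/
theorem geomSeries_eq_one_add {w : σ →₀ ℕ} (hw : w ≠ 0) :
    geomSeries w = 1 + monomial w 1 * geomSeries w := by
  classical
  have h : (1 - monomial w (1 : ℤ)) * geomSeries w = 1 := by
    apply mul_invOfUnit
    rw [map_sub, ← coeff_zero_eq_constantCoeff_apply (monomial w (1 : ℤ)), coeff_monomial,
      if_neg hw.symm]
    simp
  linear_combination h

theorem coeff_geomSeries {w : σ →₀ ℕ} (hw : w ≠ 0) (p : σ →₀ ℕ) :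
    coeff p (geomSeries w) = coeff p (1 : MvPowerSeries σ ℤ) +
      if w ≤ p then coeff (p - w) (geomSeries w) else 0 := by
  classical
  conv_lhs => rw [geomSeries_eq_one_add hw]
  rw [map_add, coeff_monomial_mul]
  simp

theorem degree_tsub_lt {w p : σ →₀ ℕ} (hw : w ≠ 0) (h : w ≤ p) :
    (p - w).degree < p.degree := by
  have h1 : (p - w).degree + w.degree = p.degree := by
    rw [← map_add, tsub_add_cancel_of_le h]
  have h2 : w.degree ≠ 0 := by simpa [Finsupp.degree_eq_zero_iff] using hw
  omega

theorem coeff_geomSeries_nonneg {w : σ →₀ ℕ} (hw : w ≠ 0) (p : σ →₀ ℕ) :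
    0 ≤ coeff p (geomSeries w) := by
  classical
  induction hn : p.degree using Nat.strong_induction_on generalizing p with
  | _ n ih =>
    rw [coeff_geomSeries hw, coeff_one]
    apply add_nonneg
    · split_ifs <;> simp
    · split_ifs with h
      · exact ih _ (hn ▸ degree_tsub_lt hw h) _ rfl
      · rfl

theorem mem_closure_of_coeff_geomSeries_ne_zero {w : σ →₀ ℕ} (hw : w ≠ 0) (p : σ →₀ ℕ)
    (hp : coeff p (geomSeries w) ≠ 0) : p ∈ AddSubmonoid.closure {w} := by
  classical
  induction hn : p.degree using Nat.strong_induction_on generalizing p with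
  | _ n ih =>
    rw [coeff_geomSeries hw, coeff_one] at hp
    by_cases h0 : p = 0
    · exact h0 ▸ zero_mem _
    rw [if_neg h0, zero_add] at hp
    by_cases h : w ≤ p
    · rw [if_pos h] at hp
      rw [← tsub_add_cancel_of_le h]
      exact add_mem (ih _ (hn ▸ degree_tsub_lt hw h) _ hp rfl)
        (AddSubmonoid.subset_closure rfl)
    · exact absurd (if_neg h) hp

theorem coeff_nsmul_geomSeries_pos {w : σ →₀ ℕ} (hw : w ≠ 0) (k : ℕ) :
    0 < coeff (k • w) (geomSeries w) := by
  classical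
  induction k with
  | zero =>
    rw [zero_smul, coeff_geomSeries hw]
    simp [hw]
  | succ k ih =>
    rw [coeff_geomSeries hw, succ_nsmul, if_pos le_add_self, add_tsub_cancel_right, coeff_one]
    split_ifs <;> omega

theorem coeff_prod_geomSeries_nonneg {w : ι → σ →₀ ℕ} (hw : ∀ i, w i ≠ 0) (s : Finset ι)
    (p : σ →₀ ℕ) : 0 ≤ coeff p (∏ i ∈ s, geomSeries (w i)) := by
  classical
  induction s using Finset.induction_on generalizing p with
  | empty => rw [Finset.prod_empty, coeff_one]; split_ifs <;> simp
  | insert i s hi ih =>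
    rw [Finset.prod_insert hi, coeff_mul]
    exact Finset.sum_nonneg fun x _ => mul_nonneg (coeff_geomSeries_nonneg (hw i) _) (ih _)

theorem coeff_prod_geomSeries_pos {w : ι → σ →₀ ℕ} (hw : ∀ i, w i ≠ 0) (s : Finset ι)
    (k : ι → ℕ) : 0 < coeff (∑ i ∈ s, k i • w i) (∏ i ∈ s, geomSeries (w i)) := by
  classical
  induction s using Finset.induction_on with
  | empty => simp
  | insert i s hi ih =>
    rw [Finset.prod_insert hi, Finset.sum_insert hi, coeff_mul]
    refine Finset.sum_pos' (fun x _ => mul_nonneg (coeff_geomSeries_nonneg (hw i) _)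
      (coeff_prod_geomSeries_nonneg hw s _)) ⟨(k i • w i, ∑ i ∈ s, k i • w i), by simp, ?_⟩
    exact mul_pos (coeff_nsmul_geomSeries_pos (hw i) _) ih

theorem mem_closure_of_coeff_prod_geomSeries_ne_zero {w : ι → σ →₀ ℕ} (hw : ∀ i, w i ≠ 0)
    (s : Finset ι) (p : σ →₀ ℕ) (hp : coeff p (∏ i ∈ s, geomSeries (w i)) ≠ 0) :
    p ∈ AddSubmonoid.closure (Set.range w) := by
  classical
  induction s using Finset.induction_on generalizing p with
  | empty =>
    rw [Finset.prod_empty, coeff_one] at hp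
    have : p = 0 := by by_contra h; simp [h] at hp
    exact this ▸ zero_mem _
  | insert i s hi ih =>
    rw [Finset.prod_insert hi, coeff_mul] at hp
    obtain ⟨x, hx, hne⟩ := Finset.exists_ne_zero_of_sum_ne_zero hp
    rw [← Finset.HasAntidiagonal.mem_antidiagonal.1 hx]
    refine add_mem (AddSubmonoid.closure_mono ?_
      (mem_closure_of_coeff_geomSeries_ne_zero (hw i) _ (left_ne_zero_of_mul hne)))
      (ih _ (right_ne_zero_of_mul hne))
    rintro _ rfl
    exact ⟨i, rfl⟩

/-- Expand the product of the `1 + u^w * geomSeries w` over finite subsets: a subset contributes to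
the coefficient at `p` only if all its `w i` are at most `p`, which leaves finitely many subsets. -/
theorem multipliable_geomSeries {w : ι → σ →₀ ℕ} (hw : ∀ i, w i ≠ 0)
    (hfin : ∀ p, {i | w i ≤ p}.Finite) : Multipliable fun i => geomSeries (w i) := by
  classical
  have hfun : (fun i => geomSeries (w i)) =
      fun i => 1 + monomial (w i) (1 : ℤ) * geomSeries (w i) :=
    funext fun i => geomSeries_eq_one_add (hw i)
  rw [hfun]
  refine multipliable_one_add_of_summable_prod ?_
  refine WithPiTopology.summable_iff_summable_coeff.mpr fun p => summable_of_hasFiniteSupport ?_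
  refine (hfin p).toFinset.powerset.finite_toSet.subset fun s hs => ?_
  have hprod : ∏ i ∈ s, monomial (w i) (1 : ℤ) = monomial (∑ i ∈ s, w i) 1 := by
    clear hs
    induction s using Finset.induction_on with
    | empty => simp [monomial_zero_eq_C_apply]
    | insert i s hi ih =>
      rw [Finset.prod_insert hi, Finset.sum_insert hi, ih, monomial_mul_monomial, one_mul]
  rw [Function.mem_support, Finset.prod_mul_distrib, hprod, coeff_monomial_mul] at hs
  have hle : ∑ i ∈ s, w i ≤ p := by
    by_contra h
    exact hs (if_neg h)
  simp only [Finset.coe_powerset, Set.mem_preimage, Set.mem_powerset_iff, Set.Finite.coe_toFinset]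
  exact fun i hi => (Finset.single_le_sum (fun _ _ => zero_le) hi).trans hle

/-- A monomial occurs in a convergent product of geometric series `(1 - u^w)⁻¹` if and only if its
exponent is a sum of exponents `w`. -/
theorem coeff_tprod_geomSeries_ne_zero_iff {w : ι → σ →₀ ℕ} (hw : ∀ i, w i ≠ 0)
    (hfin : ∀ p, {i | w i ≤ p}.Finite) (p : σ →₀ ℕ) :
    coeff p (∏' i, geomSeries (w i)) ≠ 0 ↔ p ∈ AddSubmonoid.closure (Set.range w) := by
  classical
  have hlim : Filter.Tendsto (fun s : Finset ι => coeff p (∏ i ∈ s, geomSeries (w i)))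
      Filter.atTop (nhds (coeff p (∏' i, geomSeries (w i)))) :=
    ((WithPiTopology.continuous_coeff ℤ p).tendsto _).comp
      (multipliable_geomSeries hw hfin).hasProd
  constructor
  · intro h
    by_contra hp
    refine h (tendsto_nhds_unique hlim ?_)
    refine tendsto_const_nhds.congr fun s => ?_
    by_contra hs
    exact hp (mem_closure_of_coeff_prod_geomSeries_ne_zero hw s p (Ne.symm hs))
  · intro hp
    obtain ⟨k, rfl⟩ := AddSubmonoid.mem_closure_range_iff.1 hp
    -- Every partial product over a set containing the support of `k` has a positive integer
    -- coefficient here, and the bound `1 ≤` survives the limit.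
    have hge : (1 : ℤ) ≤ coeff (k.sum fun i n => n • w i) (∏' i, geomSeries (w i)) := by
      refine ge_of_tendsto hlim (Filter.eventually_atTop.2 ⟨k.support, fun s hs => ?_⟩)
      rw [Finsupp.sum_of_support_subset k hs _ (by simp)]
      exact coeff_prod_geomSeries_pos hw s k
    omega

end GeometricProducts

/-! ### Exponents of cycles -/

section CycleExponent

variable {V E : Type*} {G : Graph V E}

/-- The number of times that a sequence of directed edges uses each edge. -/
noncomputable def edgeCount (Γ : List (DirectedEdge G)) : E →₀ ℕ :=
  (Γ.map fun d => Finsupp.single d.edge 1).sum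

/-- The exponent of the monomial `g(Γ)`. -/
noncomputable def cycleExponent (γ : Cycle (DirectedEdge G)) : E →₀ ℕ :=
  (γ.toMultiset.map fun d => Finsupp.single d.edge 1).sum

theorem cycleExponent_coe (Γ : List (DirectedEdge G)) :
    cycleExponent (Γ : Cycle (DirectedEdge G)) = edgeCount Γ := by
  simp [cycleExponent, edgeCount]

theorem degree_edgeCount (Γ : List (DirectedEdge G)) : (edgeCount Γ).degree = Γ.length := by
  induction Γ with
  | nil => simp [edgeCount]
  | cons d Γ ih =>
    have : edgeCount (d :: Γ) = Finsupp.single d.edge 1 + edgeCount Γ := by simp [edgeCount]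
    rw [this, map_add, ih, Finsupp.degree_single, List.length_cons, add_comm]

theorem edgeCount_apply [DecidableEq E] (Γ : List (DirectedEdge G)) (e : E) :
    edgeCount Γ e = (Γ.map fun d => if d.edge = e then 1 else 0).sum := by
  induction Γ with
  | nil => simp [edgeCount]
  | cons d Γ ih =>
    have : edgeCount (d :: Γ) = Finsupp.single d.edge 1 + edgeCount Γ := by simp [edgeCount]
    rw [this, Finsupp.add_apply, ih, List.map_cons, List.sum_cons, Finsupp.single_apply]

theorem edgeCount_flatten_replicate (r : ℕ) (Γ : List (DirectedEdge G)) :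
    edgeCount (List.replicate r Γ).flatten = r • edgeCount Γ := by
  induction r with
  | zero => simp [edgeCount]
  | succ r ih =>
    rw [List.replicate_succ, List.flatten_cons, succ_nsmul', ← ih]
    simp [edgeCount]

theorem cycleMonomial_eq_monomial (γ : Cycle (DirectedEdge G)) :
    cycleMonomial γ = MvPowerSeries.monomial (cycleExponent γ) 1 := by
  induction γ using Quotient.inductionOn' with
  | h Γ =>
    change cycleMonomial (Γ : Cycle (DirectedEdge G)) =
      MvPowerSeries.monomial (cycleExponent (Γ : Cycle (DirectedEdge G))) 1
    rw [cycleExponent_coe]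
    induction Γ with
    | nil => simp [cycleMonomial, edgeCount, MvPowerSeries.monomial_zero_eq_C_apply]
    | cons d Γ ih =>
      simp only [cycleMonomial, edgeCount, Cycle.coe_toMultiset, Multiset.map_coe,
        Multiset.prod_coe, List.map_cons, List.prod_cons, List.sum_cons] at ih ⊢
      rw [ih, MvPowerSeries.X, MvPowerSeries.monomial_mul_monomial, one_mul]

theorem eulerFactor_eq_geomSeries (γ : Cycle (DirectedEdge G)) :
    eulerFactor γ = geomSeries (cycleExponent γ) := by
  rw [eulerFactor, geomSeries, cycleMonomial_eq_monomial]

theorem cycleExponent_ne_zero {γ : Cycle (DirectedEdge G)} (hγ : γ ∈ primeCycles G) :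
    cycleExponent γ ≠ 0 := by
  obtain ⟨Γ, rfl, ⟨-, hne, -⟩, -⟩ := hγ
  intro h
  have := degree_edgeCount Γ
  rw [← cycleExponent_coe, h, map_zero] at this
  exact hne (List.eq_nil_of_length_eq_zero this.symm)

theorem finite_directedEdge [Finite V] [Finite E] : Finite (DirectedEdge G) :=
  Finite.of_injective (fun d => (d.source, d.edge, d.target)) fun d d' h => by
    cases d; cases d'; simp_all

/-- The degree of the exponent is the length of the cycle, and there are finitely many lists of
bounded length over a finite type. -/
theorem finite_cycleExponent_le [Finite V] [Finite E] (p : E →₀ ℕ) :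
    {γ : primeCycles G | cycleExponent (γ : Cycle (DirectedEdge G)) ≤ p}.Finite := by
  have := finite_directedEdge (G := G)
  refine Set.Finite.of_finite_image (f := Subtype.val) ?_ Subtype.val_injective.injOn
  refine ((List.finite_length_le (DirectedEdge G) p.degree).image
    (fun Γ : List (DirectedEdge G) => (Γ : Cycle (DirectedEdge G)))).subset ?_
  rintro _ ⟨γ, hγ, rfl⟩
  obtain ⟨Γ, hΓ, -⟩ := γ.2
  refine ⟨Γ, ?_, hΓ⟩
  rw [Set.mem_ofPred_eq, ← hΓ, cycleExponent_coe] at hγ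
  rw [Set.mem_ofPred_eq, ← degree_edgeCount]
  exact Finsupp.degree_mono hγ

/-- The directed edge `d'` may follow `d` in a backtrackless walk. -/
def Follows (d d' : DirectedEdge G) : Prop :=
  d.target = d'.source ∧ d.edge ≠ d'.edge

/-- A cyclic chain also relates the last entry to the first; that one extra instance of `Follows`
encodes both closing up and taillessness. -/
theorem chain_follows_iff {Γ : List (DirectedEdge G)} (hΓ : Γ ≠ []) :
    Cycle.Chain Follows (Γ : Cycle (DirectedEdge G)) ↔
      IsCycle Γ ∧ IsBacktrackless Γ ∧ IsTailless Γ := by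
  obtain ⟨a, l, rfl⟩ := List.exists_cons_of_ne_nil hΓ
  have hand : ∀ l : List (DirectedEdge G), l.IsChain Follows ↔
      l.IsChain (fun d d' => d.target = d'.source) ∧ l.IsChain (fun d d' => d.edge ≠ d'.edge) := by
    intro l
    induction l with
    | nil => simp
    | cons a l ih =>
      cases l with
      | nil => simp
      | cons b l =>
        simp only [List.isChain_cons_cons, ih, Follows]
        tauto
  rw [Cycle.chain_ne_nil _ hΓ, List.isChain_cons_cons, hand]
  simp only [IsCycle, IsBacktrackless, IsTailless, Follows, List.head_cons]
  constructor
  · rintro ⟨⟨h1, h2⟩, h3, h4⟩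
    exact ⟨⟨h3, hΓ, h1⟩, h4, fun _ => h2.symm⟩
  · rintro ⟨⟨h3, _, h1⟩, h4, h2⟩
    exact ⟨⟨h1, (h2 hΓ).symm⟩, h3, h4⟩

/-- The additive monoid generated by the exponents of the prime cycles. -/
noncomputable def primeExponents (G : Graph V E) : AddSubmonoid (E →₀ ℕ) :=
  AddSubmonoid.closure
    (Set.range fun γ : primeCycles G => cycleExponent (γ : Cycle (DirectedEdge G)))

/-- Each closed backtrackless tailless walk is a power of a prime one. -/
theorem edgeCount_mem_primeExponents {Γ : List (DirectedEdge G)} (hΓ : Γ ≠ [])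
    (hch : Cycle.Chain Follows (Γ : Cycle (DirectedEdge G))) :
    edgeCount Γ ∈ primeExponents G := by
  induction hn : Γ.length using Nat.strong_induction_on generalizing Γ with
  | _ n ih =>
    by_cases hprim : IsPrimitive Γ
    · have h := (chain_follows_iff hΓ).1 hch
      rw [← cycleExponent_coe]
      exact AddSubmonoid.subset_closure ⟨⟨_, Γ, rfl, h.1, h.2.1, h.2.2, hprim⟩, rfl⟩
    · obtain ⟨Θ, r, hΘ, hr, rfl⟩ := not_not.1 hprim
      rw [edgeCount_flatten_replicate]
      refine nsmul_mem (ih Θ.length ?_ hΘ.2.1 ?_ rfl) r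
      · have h1 : 0 < Θ.length := List.length_pos_of_ne_nil hΘ.2.1
        rw [← hn, List.length_flatten, List.map_replicate, List.sum_replicate, smul_eq_mul]
        nlinarith
      · obtain ⟨r, rfl⟩ := Nat.exists_eq_add_of_le' hr
        obtain ⟨a, l, rfl⟩ := List.exists_cons_of_ne_nil hΘ.2.1
        rw [Cycle.chain_coe_cons]
        simp only [List.replicate_succ, List.flatten_cons, List.cons_append,
          Cycle.chain_coe_cons] at hch
        -- As `Θ` is repeated at least twice, its first copy is followed by `a` again, so the cyclic
        -- chain condition for `Θ` is a prefix of the one for the power.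
        refine hch.prefix ⟨l ++ ((List.replicate r (a :: l)).flatten ++ [a]), by simp⟩

end CycleExponent

/-! ### Comparing sums along a chain with sums over the successors -/

section ChainSums

variable {α : Type*} {R : α → α → Prop}

/-- With `b = a` this compares sums around a closed walk; it is used to equate arrivals at a check
with departures from it. -/
theorem sum_map_eq_of_isChain {f g : α → ℕ} (h : ∀ x y, R x y → f x = g y) (l : List α) (a b : α)
    (hl : List.IsChain R (a :: (l ++ [b]))) :
    ((a :: l).map f).sum = ((l ++ [b]).map g).sum := by
  induction l generalizing a with
  | nil => simpa using h a b (by simpa using hl)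
  | cons c l ih =>
    rw [List.cons_append, List.isChain_cons_cons] at hl
    rw [List.map_cons, List.sum_cons, ih c hl.2, h a c hl.1, List.cons_append, List.map_cons,
      List.sum_cons]

theorem sum_map_add_le_of_isChain {f g k : α → ℕ} (h : ∀ x y, R x y → f x + g y ≤ k x)
    (l : List α) (a b : α) (hl : List.IsChain R (a :: (l ++ [b]))) :
    ((a :: l).map f).sum + ((l ++ [b]).map g).sum ≤ ((a :: l).map k).sum := by
  induction l generalizing a with
  | nil => simpa using h a b (by simpa using hl)
  | cons c l ih =>
    rw [List.cons_append, List.isChain_cons_cons] at hl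
    have h1 := ih c hl.2
    have h2 := h a c hl.1
    simp only [List.map_cons, List.sum_cons, List.cons_append] at h1 ⊢
    omega

theorem sum_map_concat (f : α → ℕ) (l : List α) (a : α) :
    ((l ++ [a]).map f).sum = ((a :: l).map f).sum := by
  simp [add_comm]

end ChainSums

/-! ### Balanced vectors -/

section Balanced

variable {J I : Type*} {H : Matrix J I (ZMod 2)}

theorem normalGraph_isLink_ne {i : I} {x y : J} (h : (normalGraph H).IsLink i x y) : x ≠ y := h.1

theorem normalGraph_isLink_apply_eq_one_iff {i : I} {x y : J} (h : (normalGraph H).IsLink i x y)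
    (j : J) : H j i = 1 ↔ x = j ∨ y = j := by
  have : j ∈ {j | H j i = 1} ↔ j ∈ ({x, y} : Set J) := by rw [h.2]
  simpa [eq_comm] using this

variable [Fintype I]

/-- At each check, the sum of the entries is even and no entry exceeds the sum of the others. -/
def IsBalanced (H : Matrix J I (ZMod 2)) (p : I → ℕ) : Prop :=
  ∀ j, Even (∑ i with H j i = 1, p i) ∧ ∀ i, H j i = 1 → 2 * p i ≤ ∑ i with H j i = 1, p i

theorem IsBalanced.zero : IsBalanced H 0 := fun j => by simp

theorem IsBalanced.add {p q : I → ℕ} (hp : IsBalanced H p) (hq : IsBalanced H q) :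
    IsBalanced H (p + q) := fun j => by
  simp only [Pi.add_apply, Finset.sum_add_distrib]
  refine ⟨(hp j).1.add (hq j).1, fun i hi => ?_⟩
  have h1 := (hp j).2 i hi
  have h2 := (hq j).2 i hi
  omega

/-- Each passage of the walk through `j` enters by one edge and leaves by a different one. So the
sum at `j` is twice the number of passages, and a given edge is used at most once per passage. -/
theorem isBalanced_edgeCount {Γ : List (DirectedEdge (normalGraph H))}
    (hch : Cycle.Chain Follows (Γ : Cycle (DirectedEdge (normalGraph H)))) :
    IsBalanced H (edgeCount Γ) := by
  classical
  cases Γ with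
  | nil => simpa [edgeCount] using! IsBalanced.zero
  | cons a l =>
  rw [Cycle.chain_coe_cons] at hch
  intro j
  set S : (DirectedEdge (normalGraph H) → ℕ) → ℕ := fun f => ((a :: l).map f).sum with hS
  have hSadd : ∀ f g, S (fun d => f d + g d) = S f + S g := fun f g => by
    simp only [hS, List.sum_map_add]
  have hsum : ∑ i with H j i = 1, edgeCount (a :: l) i =
      2 * S (fun d => if d.target = j then 1 else 0) := by
    -- The two ends of an edge differ, so each dart meeting `j` is counted exactly once, as an
    -- arrival or as a departure.
    have h1 : ∑ i with H j i = 1, edgeCount (a :: l) i =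
        S fun d => (if d.target = j then 1 else 0) + if d.source = j then 1 else 0 := by
      simp only [edgeCount_apply, hS]
      generalize a :: l = Γ
      induction Γ with
      | nil => simp
      | cons d Γ ih =>
        simp only [List.map_cons, List.sum_cons, Finset.sum_add_distrib, ih]
        congr 1
        have h := normalGraph_isLink_apply_eq_one_iff d.isLink j
        have h' := normalGraph_isLink_ne d.isLink
        rw [Finset.sum_ite_eq]
        simp only [Finset.mem_filter, Finset.mem_univ, true_and, h]
        split_ifs <;> simp_all
    have h2 := sum_map_eq_of_isChain (R := Follows)
      (f := fun d : DirectedEdge (normalGraph H) => if d.target = j then 1 else 0)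
      (g := fun d => if d.source = j then 1 else 0) (fun x y h => by simp only [h.1]) l a a hch
    rw [sum_map_concat] at h2
    rw [h1, hSadd, two_mul]
    exact congrArg₂ _ rfl h2.symm
  refine ⟨hsum ▸ even_two_mul _, fun i hi => ?_⟩
  rw [hsum]
  refine Nat.mul_le_mul_left 2 ?_
  have h1 : edgeCount (a :: l) i = S fun d => (if d.target = j ∧ d.edge = i then 1 else 0) +
      if d.source = j ∧ d.edge = i then 1 else 0 := by
    rw [edgeCount_apply]
    refine congrArg List.sum (List.map_congr_left fun d _ => ?_)
    have h := normalGraph_isLink_apply_eq_one_iff d.isLink j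
    have h' := normalGraph_isLink_ne d.isLink
    by_cases hd : d.edge = i
    · rw [hd] at h
      rcases h.1 hi with rfl | rfl
      · simp [hd, h'.symm]
      · simp [hd, h']
    · simp [hd]
  rw [h1, hSadd]
  -- Arriving at `j` by `i` and then leaving by `i` is excluded by `Follows`, so the two indicators
  -- add up to at most one per arrival.
  have h2 := sum_map_add_le_of_isChain (R := Follows)
    (f := fun d : DirectedEdge (normalGraph H) => if d.target = j ∧ d.edge = i then 1 else 0)
    (g := fun d => if d.source = j ∧ d.edge = i then 1 else 0)
    (k := fun d => if d.target = j then 1 else 0) (fun x y h => by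
      have := h.1
      have := h.2
      split_ifs <;> simp_all) l a a hch
  rwa [sum_map_concat] at h2

theorem isBalanced_of_mem_primeExponents {p : I →₀ ℕ}
    (hp : p ∈ primeExponents (normalGraph H)) : IsBalanced H p := by
  induction hp using AddSubmonoid.closure_induction with
  | mem x hx =>
    obtain ⟨⟨_, Γ, rfl, h1, h2, h3, -⟩, rfl⟩ := hx
    change IsBalanced H (cycleExponent (Γ : Cycle (DirectedEdge (normalGraph H))))
    rw [cycleExponent_coe]
    exact isBalanced_edgeCount ((chain_follows_iff h1.2.1).2 ⟨h1, h2, h3⟩)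
  | zero => exact IsBalanced.zero
  | add x y _ _ hx hy => exact hx.add hy

end Balanced

/-! ### Pairings between different classes -/

/-- If the sizes `p k` of finitely many classes have an even sum, and none of them is more than half
of it, then the elements can be grouped in pairs of elements of different classes. -/
theorem exists_pairing {K : Type*} [Fintype K] (p : K → ℕ) {m : ℕ} (hm : ∑ k, p k = 2 * m)
    (hp : ∀ k, p k ≤ m) :
    ∃ e : (Σ k, Fin (p k)) ≃ Fin 2 × Fin m,
      ∀ k (a b : Fin (p k)), (e ⟨k, a⟩).2 = (e ⟨k, b⟩).2 → a = b := by
  classical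
  let f := Fintype.equivFin K
  have hsum : ∑ x, p (f.symm x) = 2 * m := by rw [← hm, Equiv.sum_comp]
  -- List all `2 * m` elements class by class and write them into two rows of length `m`; columns
  -- are the pairs. A class is a run of at most `m` consecutive positions, so its elements have
  -- distinct residues modulo `m`.
  let e : (Σ k, Fin (p k)) ≃ Fin 2 × Fin m :=
    (Equiv.sigmaCongrLeft' (β := fun k => Fin (p k)) f).trans
      (finSigmaFinEquiv.trans ((finCongr hsum).trans finProdFinEquiv.symm))
  refine ⟨e, fun k a b hab => ?_⟩
  obtain ⟨x, rfl⟩ := f.symm.surjective k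
  have hval : ∀ c : Fin (p (f.symm x)), ((e ⟨f.symm x, c⟩).2 : ℕ) =
      (∑ y : Fin x, p (f.symm (Fin.castLE x.2.le y)) + c) % m := by
    intro c
    have hc : Equiv.sigmaCongrLeft' (β := fun k => Fin (p k)) f ⟨f.symm x, c⟩ = ⟨x, c⟩ := by
      rw [Equiv.sigmaCongrLeft', ← Equiv.eq_symm_apply]
      rfl
    simp only [e, Equiv.trans_apply, hc, finProdFinEquiv_symm_apply, Fin.coe_modNat,
      finCongr_apply, Fin.val_cast, finSigmaFinEquiv_apply]
  have h := congrArg Fin.val hab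
  rw [hval, hval] at h
  have h' : (a : ℕ) ≡ b [MOD m] := Nat.ModEq.add_left_cancel' _ h
  exact Fin.ext (h'.eq_of_lt_of_lt (a.2.trans_le (hp _)) (b.2.trans_le (hp _)))

/-! ### Decomposition of a system of darts into cycles -/

section Darts

variable {V E : Type*} {G : Graph V E} {D : Type*}

/-- Conjugation by `r` inverts `f = τ * r`. If `r d = f ^ n d`, the point halfway is fixed: for `n =
2 * k`, `r` fixes `f ^ k d`; for `n = 2 * k + 1`, `τ` fixes `r (f ^ k d)`. Hence a closed walk never
runs into its own reversal. -/
theorem not_sameCycle_of_involutive {r τ : Equiv.Perm D} (hr : Function.Involutive r)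
    (hτ : Function.Involutive τ) (hr' : ∀ d, r d ≠ d) (hτ' : ∀ d, τ d ≠ d) (d : D) :
    ¬ (τ * r).SameCycle d (r d) := by
  have hconj : ∀ (n : ℤ) (x : D), r (((τ * r) ^ n) x) = ((τ * r) ^ (-n)) (r x) := by
    have hr2 : r * r = 1 := Equiv.ext hr
    have hτ2 : τ * τ = 1 := Equiv.ext hτ
    have h1 : r * (τ * r) * r⁻¹ = (τ * r)⁻¹ := by
      rw [eq_inv_iff_mul_eq_one, inv_eq_of_mul_eq_one_right hr2]
      simp only [mul_assoc]
      rw [← mul_assoc r r, hr2, one_mul, ← mul_assoc τ τ, hτ2, one_mul, hr2]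
    intro n x
    have h2 : r * (τ * r) ^ n = (τ * r) ^ (-n) * r := by
      rw [zpow_neg, ← inv_zpow, ← h1, conj_zpow, inv_mul_cancel_right]
    exact congrArg (fun f : Equiv.Perm D => f x) h2
  rintro ⟨n, hn⟩
  obtain ⟨k, hk⟩ := Int.even_or_odd' n
  rcases hk with rfl | rfl
  · apply hr' (((τ * r) ^ k) d)
    rw [hconj, ← hn, ← Equiv.Perm.mul_apply, ← zpow_add]
    congr 2
    ring
  · apply hτ' (r (((τ * r) ^ k) d))
    have h1 : τ (r (((τ * r) ^ k) d)) = ((τ * r) ^ (1 + k)) d := by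
      rw [zpow_add, zpow_one]
      rfl
    rw [h1, hconj, ← hn, ← Equiv.Perm.mul_apply, ← zpow_add]
    congr 2
    ring

theorem chain_toList [Fintype D] [DecidableEq D] (f : Equiv.Perm D) (d : D) :
    Cycle.Chain (fun x y => f x = y) (f.toList d : Cycle D) := by
  by_cases hd : d ∈ f.support
  · have hne : f.toList d ≠ [] := by simpa using hd
    have hpos := List.length_pos_of_ne_nil hne
    rw [Cycle.chain_ne_nil _ hne, List.isChain_cons]
    constructor
    · intro y hy
      rw [List.head?_eq_getElem?, List.getElem?_eq_getElem hpos, Option.mem_some_iff] at hy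
      rw [← hy, List.getLast_eq_getElem, Equiv.Perm.getElem_toList, Equiv.Perm.getElem_toList,
        ← Equiv.Perm.mul_apply, ← pow_succ', Nat.sub_add_cancel hpos, Equiv.Perm.length_toList]
      have h := Equiv.Perm.pow_mod_card_support_cycleOf_self_apply f
        (f.cycleOf d).support.card d
      rw [Nat.mod_self] at h
      exact h.symm
    · rw [List.isChain_iff_getElem]
      intro i hi
      rw [Equiv.Perm.getElem_toList, Equiv.Perm.getElem_toList, pow_succ', Equiv.Perm.mul_apply]
  -- At a fixed point `toList` is empty, not a singleton.
  · rw [Equiv.Perm.toList_eq_nil_iff.2 hd]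
    exact Cycle.Chain.nil _

/-- A finite system of darts, with a reversal `r` and a pairing `τ` at the sources, splits into
closed backtrackless walks and their reversals. -/
theorem exists_sum_single_eq_two_nsmul [Fintype D] [DecidableEq D] {r τ : Equiv.Perm D}
    (hr : Function.Involutive r) (hτ : Function.Involutive τ) (hr' : ∀ d, r d ≠ d)
    (φ : D → DirectedEdge G) (hredge : ∀ d, (φ (r d)).edge = (φ d).edge)
    (hrsource : ∀ d, (φ (r d)).source = (φ d).target)
    (hτsource : ∀ d, (φ (τ d)).source = (φ d).source)
    (hτedge : ∀ d, (φ (τ d)).edge ≠ (φ d).edge) (S : Finset D)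
    (hrS : ∀ d ∈ S, r d ∈ S) (hτS : ∀ d ∈ S, τ d ∈ S) :
    ∃ q ∈ primeExponents G, ∑ d ∈ S, Finsupp.single (φ d).edge 1 = 2 • q := by
  induction S using Finset.strongInduction with
  | H S ih =>
  obtain rfl | ⟨d, hd⟩ := S.eq_empty_or_nonempty
  · exact ⟨0, zero_mem _, by simp⟩
  have hτ' : ∀ d, τ d ≠ d := fun d h => hτedge d (by rw [h])
  -- One step of the walk: traverse the dart, so that its reversal starts where the walk stands,
  -- then change to the partner there, which lies on another edge.
  set f := τ * r with hf
  have hfollow : ∀ x, Follows (φ x) (φ (f x)) := fun x =>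
    ⟨by rw [hf, Equiv.Perm.mul_apply, hτsource, hrsource], by
      rw [hf, Equiv.Perm.mul_apply, ← hredge x]; exact (hτedge _).symm⟩
  have hsupp : d ∈ f.support := by
    rw [Equiv.Perm.mem_support]
    intro h
    have := (hfollow d).2
    rw [h] at this
    exact this rfl
  have hfS : ∀ x ∈ S, f x ∈ S := fun x hx => hτS _ (hrS _ hx)
  set O := (f.toList d).toFinset with hO
  have memO : ∀ x, x ∈ O ↔ f.SameCycle d x := fun x => by
    rw [hO, List.mem_toFinset, Equiv.Perm.mem_toList_iff, and_iff_left hsupp]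
  have hOS : O ⊆ S := by
    intro x hx
    obtain ⟨n, rfl⟩ := ((memO x).1 hx).exists_nat_pow_eq
    clear hx
    induction n with
    | zero => simpa
    | succ n ihn => rw [pow_succ', Equiv.Perm.mul_apply]; exact hfS _ ihn
  set O' := O.image r with hO'
  have hO'S : O' ⊆ S := by
    intro x hx
    obtain ⟨y, hy, rfl⟩ := Finset.mem_image.1 hx
    exact hrS _ (hOS hy)
  have hdisj : Disjoint O O' := by
    rw [Finset.disjoint_left]
    intro x hx hx'
    obtain ⟨y, hy, rfl⟩ := Finset.mem_image.1 hx'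
    exact not_sameCycle_of_involutive hr hτ hr' hτ' y
      (((memO _).1 hy).symm.trans ((memO _).1 hx))
  have rO : ∀ x, r x ∈ O ∪ O' ↔ x ∈ O ∪ O' := by
    intro x
    simp only [Finset.mem_union, hO', Finset.mem_image]
    constructor
    · rintro (h | ⟨y, hy, hyx⟩)
      · exact Or.inr ⟨r x, h, hr x⟩
      · exact Or.inl (r.injective hyx ▸ hy)
    · rintro (h | ⟨y, hy, rfl⟩)
      · exact Or.inr ⟨x, h, rfl⟩
      · exact Or.inl ((hr y).symm ▸ hy)
  have fO : ∀ x, f x ∈ O ↔ x ∈ O := fun x => by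
    rw [memO, memO, Equiv.Perm.sameCycle_apply_right]
  -- On the orbit, `r (τ x)` is the predecessor of `x`; on its reversal, `τ (r y)` is `f y`.
  have τO : ∀ x ∈ O ∪ O', τ x ∈ O ∪ O' := by
    intro x hx
    rw [Finset.mem_union] at hx
    rcases hx with hx | hx
    · rw [← rO, Finset.mem_union]
      refine Or.inl ((fO _).1 ?_)
      rwa [hf, Equiv.Perm.mul_apply, hr, hτ]
    · obtain ⟨y, hy, rfl⟩ := Finset.mem_image.1 hx
      exact Finset.mem_union_left _ ((fO y).2 hy)
  have τO' : ∀ x, τ x ∈ O ∪ O' → x ∈ O ∪ O' := fun x hx => by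
    have := τO _ hx
    rwa [hτ] at this
  have hsub : O ∪ O' ⊆ S := Finset.union_subset hOS hO'S
  have hdO : d ∈ O := (memO d).2 (Equiv.Perm.SameCycle.refl f d)
  obtain ⟨q, hq, hqsum⟩ := ih (S \ (O ∪ O'))
    (Finset.sdiff_ssubset hsub ⟨d, Finset.mem_union_left _ hdO⟩)
    (fun x hx => by
      rw [Finset.mem_sdiff] at hx ⊢
      exact ⟨hrS x hx.1, fun h => hx.2 ((rO x).1 h)⟩)
    (fun x hx => by
      rw [Finset.mem_sdiff] at hx ⊢
      exact ⟨hτS x hx.1, fun h => hx.2 (τO' x h)⟩)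
  have hOsum : ∑ x ∈ O, Finsupp.single (φ x).edge 1 = edgeCount ((f.toList d).map φ) := by
    rw [hO, List.sum_toFinset _ (Equiv.Perm.nodup_toList f d), edgeCount, List.map_map]
    rfl
  have hO'sum : ∑ x ∈ O', Finsupp.single (φ x).edge 1 = edgeCount ((f.toList d).map φ) := by
    rw [hO', Finset.sum_image r.injective.injOn, ← hOsum]
    simp only [hredge]
  -- The orbit and its disjoint reversal use the same edges equally often, which accounts for the
  -- factor 2.
  refine ⟨q + edgeCount ((f.toList d).map φ), add_mem hq (edgeCount_mem_primeExponents ?_ ?_), ?_⟩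
  · simpa using hsupp
  · have h := (chain_toList f d).imp (r₂ := fun x y => Follows (φ x) (φ y))
      (by rintro x _ rfl; exact hfollow x)
    exact (Cycle.chain_map (r := Follows) φ).2 h
  · rw [← Finset.sum_sdiff hsub, hqsum, Finset.sum_union hdisj, hOsum, hO'sum, smul_add, two_smul,
      two_smul]

end Darts

/-! ### From balanced vectors to sums of prime cycle exponents -/

section BalancedToCycles

variable {J I : Type*} {H : Matrix J I (ZMod 2)}

theorem IsCycleCode.ncard_eq_two (hH : IsCycleCode H) (i : I) : {j | H j i = 1}.ncard = 2 := by
  have hset : (tannerGraph H).neighborSet (Sum.inl i) = Sum.inr '' {j | H j i = 1} := by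
    ext x
    simp only [SimpleGraph.mem_neighborSet, tannerGraph, Set.mem_image, Set.mem_ofPred_eq]
    constructor
    · rintro (⟨i', j', h1, h2, h3⟩ | ⟨i', j', h1, -⟩)
      · cases h1
        exact ⟨j', h3, h2.symm⟩
      · cases h1
    · rintro ⟨j', h3, rfl⟩
      exact Or.inl ⟨i, j', rfl, rfl, h3⟩
  have h := hH i
  rwa [hset, Set.ncard_image_of_injective _ Sum.inr_injective] at h

theorem IsCycleCode.exists_isLink (hH : IsCycleCode H) {i : I} {j : J} (h : H j i = 1) :
    ∃ j', (normalGraph H).IsLink i j j' := by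
  obtain ⟨x, y, hxy, hs⟩ := Set.ncard_eq_two.1 (hH.ncard_eq_two i)
  have hj : j ∈ ({x, y} : Set J) := hs ▸ h
  rcases hj with rfl | rfl
  · exact ⟨y, hxy, hs⟩
  · exact ⟨x, hxy.symm, hs.trans (Set.pair_comm x j)⟩

/-- The pairing of `exists_pairing` at a check. -/
theorem IsBalanced.exists_pairing [Fintype I] {p : I → ℕ} (hp : IsBalanced H p) (j : J) :
    ∃ m, ∃ e : (Σ k : {i // H j i = 1}, Fin (p k)) ≃ Fin 2 × Fin m, m ≤ ∑ i, p i ∧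
      ∀ (k : {i // H j i = 1}) (a b : Fin (p k)), (e ⟨k, a⟩).2 = (e ⟨k, b⟩).2 → a = b := by
  obtain ⟨⟨m, hm⟩, hle⟩ := hp j
  have hsum : ∑ k : {i // H j i = 1}, p k = 2 * m := by
    rw [two_mul, ← hm]
    exact (Finset.sum_subtype _ (by simp) p).symm
  obtain ⟨e, he⟩ := CycleCode.exists_pairing (fun k : {i // H j i = 1} => p k) hsum fun k => by
    have := hle k k.2
    omega
  refine ⟨m, e, ?_, he⟩
  have : ∑ i with H j i = 1, p i ≤ ∑ i, p i := Finset.sum_le_univ_sum_of_nonneg fun _ => zero_le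
  omega

/-- A dart is one of the `p i` copies of an edge `i`, seen from one of its two ends. Reversal
changes the end and keeps the copy; the pairing at each check gives `τ`. Every copy counts twice, so
the decomposition yields `2 • p = 2 • q`. -/
theorem IsBalanced.mem_primeExponents [Fintype J] [Fintype I] (hH : IsCycleCode H) {p : I →₀ ℕ}
    (hp : IsBalanced H p) : p ∈ primeExponents (normalGraph H) := by
  classical
  have : ∀ j, Fintype {i // H j i = 1} := fun j => Subtype.fintype _
  choose m e _ he using hp.exists_pairing
  choose o ho using fun (i : I) (j : J) (h : H j i = 1) => hH.exists_isLink h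
  have ho' : ∀ i j h, H (o i j h) i = 1 := fun i j h =>
    (normalGraph_isLink_apply_eq_one_iff (ho i j h) _).2 (Or.inr rfl)
  have hoo : ∀ i j h, o i (o i j h) (ho' i j h) = j := fun i j h => by
    have h1 := (normalGraph_isLink_apply_eq_one_iff (ho i (o i j h) (ho' i j h)) j).1 h
    exact h1.resolve_left (normalGraph_isLink_ne (ho i j h)).symm
  let D := Σ j : J, Σ k : {i // H j i = 1}, Fin (p k)
  let φ : D → DirectedEdge (normalGraph H) := fun d => ⟨d.1, d.2.1, _, ho _ _ d.2.1.2⟩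
  -- Reversing twice returns to the same check only up to a propositional equality, on which the
  -- type of the rest of the dart depends.
  have hext : ∀ {j j' : J} (hjj : j' = j) {i : I} (h : H j i = 1) (h' : H j' i = 1) (a : Fin (p i)),
      (⟨j', ⟨⟨i, h'⟩, a⟩⟩ : D) = ⟨j, ⟨⟨i, h⟩, a⟩⟩ := by
    rintro j _ rfl i h h' a
    rfl
  let r₀ : D → D := fun d => ⟨o d.2.1 d.1 d.2.1.2, ⟨⟨d.2.1, ho' _ _ _⟩, d.2.2⟩⟩
  have hr : Function.Involutive r₀ := by
    rintro ⟨j, ⟨⟨i, h⟩, a⟩⟩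
    exact hext (hoo i j h) h _ a
  -- The partner sits in the same column and the other row.
  let τ₀ : D → D := fun d => ⟨d.1, (e d.1).symm (Fin.rev (e d.1 d.2).1, (e d.1 d.2).2)⟩
  have hτ : Function.Involutive τ₀ := by
    rintro ⟨j, x⟩
    refine Sigma.ext rfl (heq_of_eq ?_)
    change (e j).symm (Fin.rev (e j ((e j).symm _)).1, (e j ((e j).symm _)).2) = x
    rw [Equiv.apply_symm_apply, Fin.rev_rev, Prod.mk.eta, Equiv.symm_apply_apply]
  have hτedge : ∀ d, (φ (τ₀ d)).edge ≠ (φ d).edge := by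
    rintro ⟨j, ⟨k, a⟩⟩ h
    obtain ⟨y, hy⟩ : ∃ y, y = (e j).symm (Fin.rev (e j ⟨k, a⟩).1, (e j ⟨k, a⟩).2) := ⟨_, rfl⟩
    have h1 : y.1 = k := by
      rw [hy]
      exact Subtype.ext h
    obtain ⟨k', b⟩ := y
    dsimp only at h1
    subst h1
    rw [Equiv.eq_symm_apply] at hy
    -- Two copies of the same edge in one column coincide, yet partners lie in different rows.
    have hba := he j _ b a (by rw [hy])
    rw [hba] at hy
    have := congrArg Prod.fst hy
    exact absurd this.symm ((by decide : ∀ z : Fin 2, Fin.rev z ≠ z) _)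
  obtain ⟨q, hq, hsum⟩ := exists_sum_single_eq_two_nsmul (r := hr.toPerm) (τ := hτ.toPerm) hr hτ
    (fun d h => normalGraph_isLink_ne (ho d.2.1 d.1 d.2.1.2) (congrArg Sigma.fst h).symm)
    φ (fun _ => rfl) (fun _ => rfl) (fun _ => rfl) hτedge Finset.univ (by simp) (by simp)
  suffices h : ∑ d : D, Finsupp.single (φ d).edge 1 = 2 • p by
    rw [h] at hsum
    have : p = q := by
      ext i
      have := DFunLike.congr_fun hsum i
      simp only [Finsupp.smul_apply, smul_eq_mul] at this
      omega
    rwa [this]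
  ext i
  have hcard : (Finset.univ.filter fun j => H j i = 1).card = 2 := by
    have h := hH.ncard_eq_two i
    rwa [← Finset.coe_filter_univ, Set.ncard_coe_finset] at h
  have htwo : (2 • p) i = ∑ j, if H j i = 1 then p i else 0 := by
    rw [← Finset.sum_filter, Finset.sum_const, hcard, Finsupp.smul_apply]
  rw [htwo, Fintype.sum_sigma, Finsupp.finsetSum_apply]
  refine Finset.sum_congr rfl fun j _ => ?_
  rw [Fintype.sum_sigma]
  simp only [φ, Finset.sum_const, Finset.card_univ, Fintype.card_fin, Finsupp.finsetSum_apply,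
    Finsupp.smul_apply, Finsupp.single_apply, smul_eq_mul]
  rw [← Finset.sum_subtype (Finset.univ.filter fun i => H j i = 1) (by simp)
    (fun x => p x * if x = i then 1 else 0)]
  simp [Finset.sum_ite_eq']

end BalancedToCycles

/-! ### Unscaled pseudo-codewords are balanced -/

section CoverToBalanced

variable {J I : Type*} {H : Matrix J I (ZMod 2)}

theorem tannerGraph_adj_inl_inr {i : I} {j : J} :
    (tannerGraph H).Adj (Sum.inl i) (Sum.inr j) ↔ H j i = 1 := by
  simp [tannerGraph]

theorem tannerGraph_adj_inr_inl {i : I} {j : J} :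
    (tannerGraph H).Adj (Sum.inr j) (Sum.inl i) ↔ H j i = 1 := by
  simp [tannerGraph]

variable {W : Type*} {Y : SimpleGraph W}

theorem IsMCover.existsUnique_adj {V : Type*} {X : SimpleGraph V} {π : Y →g X} {M : ℕ}
    (hπ : IsMCover π M) (w : W) {x : V} (hx : X.Adj (π w) x) : ∃! w', Y.Adj w w' ∧ π w' = x := by
  obtain ⟨w', hw', hw'x⟩ := (hπ.bijOn_neighborSet w).surjOn hx
  exact ⟨w', ⟨hw', hw'x⟩, fun y hy =>
    (hπ.bijOn_neighborSet w).injOn hy.1 hw' (hy.2.trans hw'x.symm)⟩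

/-- Balancedness holds at each copy `w` of a check, where `N w i` is the value at the unique
neighbour over `i`, and it is additive. Each bit node over `i` has exactly one neighbour over `j`,
so summing `N w i` over the copies of `j` recovers `p i`. -/
theorem IsMCover.isBalanced [Fintype W] [Fintype I] {π : Y →g tannerGraph H} {M : ℕ}
    (hπ : IsMCover π M) {c : BitNode π → ZMod 2} (hc : c ∈ binaryCode (coverMatrix π)) {p : I → ℕ}
    (hp : ∀ i, p i = ∑ b : BitNode π, open Classical in
      if π b.1 = Sum.inl i then (c b).val else 0) :
    IsBalanced H p := by
  classical
  let N : W → I → ℕ := fun w i =>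
    ∑ b : BitNode π, if Y.Adj w b ∧ π b = Sum.inl i then (c b).val else 0
  have hN : ∀ w i j, π w = Sum.inr j → H j i = 1 → N w i < 2 := by
    intro w i j hw hij
    obtain ⟨b, ⟨hb, hbi⟩, huniq⟩ := hπ.existsUnique_adj w (x := Sum.inl i)
      (by rw [hw]; exact tannerGraph_adj_inr_inl.2 hij)
    have : N w i = (c ⟨b, by simp [hbi]⟩).val := by
      refine (Finset.sum_eq_single ⟨b, by simp [hbi]⟩ (fun b' _ hne => if_neg fun h => hne
        (Subtype.ext (huniq _ h))) (by simp)).trans (if_pos ⟨hb, hbi⟩)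
    rw [this]
    exact ZMod.val_lt _
  have hNzero : ∀ w i j, π w = Sum.inr j → H j i ≠ 1 → N w i = 0 := by
    intro w i j hw hij
    refine Finset.sum_eq_zero fun b _ => if_neg fun h => hij ?_
    have := π.map_adj h.1
    rw [hw, h.2] at this
    exact tannerGraph_adj_inr_inl.1 this
  have hNsum : ∀ i j, H j i = 1 → p i = ∑ w with π w = Sum.inr j, N w i := by
    intro i j hij
    rw [hp, Finset.sum_comm]
    refine Finset.sum_congr rfl fun b _ => ?_
    by_cases hb : π b = Sum.inl i
    · obtain ⟨w, ⟨hw, hwj⟩, huniq⟩ := hπ.existsUnique_adj b.1 (x := Sum.inr j)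
        (by rw [hb]; exact tannerGraph_adj_inl_inr.2 hij)
      rw [if_pos hb]
      refine ((Finset.sum_eq_single w (fun w' hw' hne => if_neg fun h => hne
        (huniq w' ⟨h.1.symm, (Finset.mem_filter.1 hw').2⟩)) (fun h => ?_)).trans
          (if_pos ⟨hw.symm, hb⟩)).symm
      exact absurd (Finset.mem_filter.2 ⟨Finset.mem_univ w, hwj⟩) h
    · simp [hb]
  have hNeven : ∀ w j, π w = Sum.inr j → Even (∑ i with H j i = 1, N w i) := by
    intro w j hw
    rw [Finset.sum_filter_of_ne fun i _ hi => by_contra fun h => hi (hNzero w i j hw h)]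
    have h1 : ∑ i, N w i = ∑ b : BitNode π, if Y.Adj w b then (c b).val else 0 := by
      rw [Finset.sum_comm]
      refine Finset.sum_congr rfl fun b _ => ?_
      obtain ⟨i, hi⟩ := Sum.isLeft_iff.1 b.2
      simp only [hi, Sum.inl.injEq, ite_and]
      split_ifs <;> simp
    rw [h1, ← ZMod.natCast_eq_zero_iff_even]
    have h2 : (coverMatrix π).mulVec c ⟨w, by simp [hw]⟩ = 0 :=
      congrFun (LinearMap.mem_ker.1 hc) _
    rw [← h2, Matrix.mulVec, dotProduct, Nat.cast_sum]
    refine Finset.sum_congr rfl fun b _ => ?_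
    simp only [coverMatrix, Nat.cast_ite, ZMod.natCast_zmod_val, Nat.cast_zero, ite_mul, one_mul,
      zero_mul]
  intro j
  have hsum : ∑ i with H j i = 1, p i =
      ∑ w with π w = Sum.inr j, ∑ i with H j i = 1, N w i := by
    rw [Finset.sum_comm]
    exact Finset.sum_congr rfl fun i hi => hNsum i j (Finset.mem_filter.1 hi).2
  rw [hsum]
  refine ⟨Finset.even_sum _ fun w hw => hNeven w j (Finset.mem_filter.1 hw).2, fun i hij => ?_⟩
  rw [hNsum i j hij, Finset.mul_sum]
  refine Finset.sum_le_sum fun w hw => ?_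
  have hwj := (Finset.mem_filter.1 hw).2
  have h1 := hN w i j hwj hij
  have h2 : N w i ≤ ∑ i with H j i = 1, N w i :=
    Finset.single_le_sum (fun _ _ => zero_le) (Finset.mem_filter.2 ⟨Finset.mem_univ _, hij⟩)
  -- `N w i` is 0 or 1; if it is 1, the even sum containing it is at least 2.
  obtain ⟨k, hk⟩ := hNeven w j hwj
  omega

theorem IsUnscaledPseudoCodeword.isBalanced [Fintype I] {p : I → ℕ}
    (hp : IsUnscaledPseudoCodeword H fun i => (p i : ℚ)) : IsBalanced H p := by
  classical
  obtain ⟨M, W, _, Y, π, hM, hπ, c, hc, h⟩ := hp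
  refine hπ.isBalanced hc fun i => ?_
  have hi := congrFun h i
  rw [Pi.smul_apply, pseudoCodeword, smul_eq_mul, ← mul_assoc, mul_one_div_cancel (by positivity),
    one_mul, Finset.sum_filter] at hi
  have : (p i : ℚ) = ((∑ b : BitNode π, if π b.1 = Sum.inl i then (c b).val else 0 : ℕ) : ℚ) := by
    rw [hi]
    push_cast
    exact Finset.sum_congr rfl fun b _ => by split_ifs <;> rfl
  exact (Nat.cast_injective this).trans (Finset.sum_congr rfl fun b _ => by split_ifs <;> rfl)

end CoverToBalanced

/-! ### Covers given by permutations -/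

section BalancedToCover

variable {J I : Type*} {H : Matrix J I (ZMod 2)} {M : ℕ}

/-- The cover of the Tanner graph in which copy `k` of bit `i` is joined to copy `σ i j k` of
check `j`. -/
def liftGraph (H : Matrix J I (ZMod 2)) (σ : I → J → Equiv.Perm (Fin M)) :
    SimpleGraph ((I ⊕ J) × Fin M) where
  Adj x y := (∃ i j, x.1 = Sum.inl i ∧ y.1 = Sum.inr j ∧ H j i = 1 ∧ σ i j x.2 = y.2) ∨
    (∃ i j, x.1 = Sum.inr j ∧ y.1 = Sum.inl i ∧ H j i = 1 ∧ σ i j y.2 = x.2)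
  symm := ⟨by
    rintro x y (⟨i, j, h⟩ | ⟨i, j, h⟩)
    · exact Or.inr ⟨i, j, h.2.1, h.1, h.2.2⟩
    · exact Or.inl ⟨i, j, h.2.1, h.1, h.2.2⟩⟩
  loopless := ⟨by
    rintro x (⟨i, j, h, h', -⟩ | ⟨i, j, h, h', -⟩) <;> simp [h] at h'⟩

theorem liftGraph_adj_inr_inl {σ : I → J → Equiv.Perm (Fin M)} {i : I} {j : J} {k l : Fin M} :
    (liftGraph H σ).Adj (Sum.inr j, l) (Sum.inl i, k) ↔ H j i = 1 ∧ σ i j k = l := by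
  simp [liftGraph]

theorem liftGraph_adj_inl_inr {σ : I → J → Equiv.Perm (Fin M)} {i : I} {j : J} {k l : Fin M} :
    (liftGraph H σ).Adj (Sum.inl i, k) (Sum.inr j, l) ↔ H j i = 1 ∧ σ i j k = l := by
  simp [liftGraph]

/-- The projection to the Tanner graph of a relabelled `liftGraph`. -/
def liftProj {W : Type*} (f : W ≃ (I ⊕ J) × Fin M) (σ : I → J → Equiv.Perm (Fin M)) :
    (liftGraph H σ).comap f →g tannerGraph H where
  toFun w := (f w).1
  map_rel' := by
    rintro a b (⟨i, j, h1, h2, h3, -⟩ | ⟨i, j, h1, h2, h3, -⟩)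
    · exact Or.inl ⟨i, j, h1, h2, h3⟩
    · exact Or.inr ⟨i, j, h1, h2, h3⟩

theorem bijOn_fst_liftGraph_neighborSet (σ : I → J → Equiv.Perm (Fin M)) (x : (I ⊕ J) × Fin M) :
    Set.BijOn Prod.fst ((liftGraph H σ).neighborSet x) ((tannerGraph H).neighborSet x.1) := by
  obtain ⟨i | j, k⟩ := x
  · refine ⟨?_, ?_, ?_⟩
    · rintro ⟨i' | j, l⟩ h
      · simp [liftGraph] at h
      · exact tannerGraph_adj_inl_inr.2 (liftGraph_adj_inl_inr.1 h).1
    · rintro ⟨y, l⟩ h ⟨_, l'⟩ h' rfl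
      obtain i' | j := y
      · simp [liftGraph] at h
      · rw [← (liftGraph_adj_inl_inr.1 h).2, ← (liftGraph_adj_inl_inr.1 h').2]
    · rintro (i' | j) h
      · simp [tannerGraph] at h
      · exact ⟨(Sum.inr j, σ i j k), liftGraph_adj_inl_inr.2 ⟨tannerGraph_adj_inl_inr.1 h, rfl⟩, rfl⟩
  · refine ⟨?_, ?_, ?_⟩
    · rintro ⟨i | j', l⟩ h
      · exact tannerGraph_adj_inr_inl.2 (liftGraph_adj_inr_inl.1 h).1
      · simp [liftGraph] at h
    · rintro ⟨y, l⟩ h ⟨_, l'⟩ h' rfl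
      obtain i | j' := y
      · rw [(σ i j).injective
          ((liftGraph_adj_inr_inl.1 h).2.trans (liftGraph_adj_inr_inl.1 h').2.symm)]
      · simp [liftGraph] at h
    · rintro (i | j') h
      · exact ⟨(Sum.inl i, (σ i j).symm k),
          liftGraph_adj_inr_inl.2 ⟨tannerGraph_adj_inr_inl.1 h, by simp⟩, rfl⟩
      · simp [tannerGraph] at h

theorem isMCover_liftProj {W : Type*} (hM : 0 < M) (f : W ≃ (I ⊕ J) × Fin M)
    (σ : I → J → Equiv.Perm (Fin M)) : IsMCover (liftProj (H := H) f σ) M where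
  surjective x := ⟨f.symm (x, ⟨0, hM⟩), by simp [liftProj]⟩
  bijOn_neighborSet y := by
    have h := bijOn_fst_liftGraph_neighborSet (H := H) σ (f y)
    refine ⟨fun w hw => h.mapsTo hw, fun w hw w' hw' hww' => f.injective (h.injOn hw hw' hww'),
      fun x hx => ?_⟩
    obtain ⟨a, ha, hax⟩ := h.surjOn hx
    refine ⟨f.symm a, ?_, ?_⟩
    · change (liftGraph H σ).Adj (f y) (f (f.symm a))
      rwa [f.apply_symm_apply]
    · change (f (f.symm a)).1 = x
      rwa [f.apply_symm_apply]
  ncard_fiber x := by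
    have h : liftProj (H := H) f σ ⁻¹' {x} = (fun k => f.symm (x, k)) '' Set.univ := by
      ext w
      simp only [liftProj, RelHom.coeFn_mk, Set.mem_preimage, Set.mem_singleton_iff,
        Set.image_univ, Set.mem_range]
      constructor
      · rintro rfl
        exact ⟨(f w).2, by simp⟩
      · rintro ⟨k, rfl⟩
        simp
    rw [h, Set.ncard_image_of_injective _ (fun k k' hk => by simpa using hk), Set.ncard_univ]
    simp

theorem sum_bitNode_liftProj [Fintype I] {W A : Type*} [Fintype W] [AddCommMonoid A]
    (f : W ≃ (I ⊕ J) × Fin M) (σ : I → J → Equiv.Perm (Fin M)) (g : (I ⊕ J) × Fin M → A) :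
    ∑ b : BitNode (liftProj (H := H) f σ), g (f b) = ∑ i, ∑ k, g (Sum.inl i, k) := by
  let ψ : I × Fin M → BitNode (liftProj (H := H) f σ) := fun x =>
    ⟨f.symm (Sum.inl x.1, x.2), by simp [liftProj]⟩
  have hψ : Function.Bijective ψ := by
    constructor
    · intro x y h
      have := f.symm.injective (congrArg Subtype.val h)
      simpa [Prod.ext_iff] using this
    · rintro ⟨w, hw⟩
      obtain ⟨i, hi⟩ := Sum.isLeft_iff.1 hw
      refine ⟨(i, (f w).2), Subtype.ext ?_⟩
      change f.symm (Sum.inl i, (f w).2) = w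
      rw [Equiv.symm_apply_eq, ← hi]
      rfl
  rw [← Fintype.sum_prod_type', ← hψ.sum_comp]
  simp [ψ]

theorem sum_ite_val_lt {A : Type*} [AddCommMonoid A] {n : ℕ} (h : n ≤ M) (g : Fin M → A) :
    ∑ k : Fin M, (if (k : ℕ) < n then g k else 0) = ∑ a, g (Fin.castLE h a) := by
  obtain ⟨d, rfl⟩ := Nat.exists_eq_add_of_le h
  rw [Fin.sum_univ_add]
  simp only [Fin.val_castAdd, Fin.is_lt, if_true, Fin.val_natAdd, Nat.not_lt.2 (Nat.le_add_right _ _),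
    if_false, Finset.sum_const_zero, add_zero]
  rfl

/-- An injection of an initial segment extends to a permutation. -/
theorem exists_perm_castLE {n : ℕ} (h : n ≤ M) (g : Fin n → Fin M) (hg : Function.Injective g) :
    ∃ σ : Equiv.Perm (Fin M), ∀ a, σ (Fin.castLE h a) = g a := by
  have hext : ∀ a, Function.extend (Fin.castLE h) g id (Fin.castLE h a) = g a := fun a =>
    (Fin.castLE_injective h).extend_apply g id a
  obtain ⟨e, he⟩ := Set.MapsTo.exists_equiv_extend_of_card_eq (α := Fin M)
    (t := (Finset.univ : Finset (Fin M))) (by simp) (s := Set.range (Fin.castLE h))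
    (f := Function.extend (Fin.castLE h) g id) (fun _ _ => by simp) (by
      rintro _ ⟨a, rfl⟩ _ ⟨b, rfl⟩ hab
      rw [hext, hext] at hab
      rw [hg hab])
  refine ⟨e.trans (Equiv.subtypeUnivEquiv fun _ => Finset.mem_univ _), fun a => ?_⟩
  exact (he _ ⟨a, rfl⟩).trans (hext a)

/-- The first `p i` copies of bit `i` carry the value 1. At check `j` the permutations send them to
the column of the pairing in which they lie, so a check copy below `m j` sees exactly two ones and
any other sees none. -/
theorem IsBalanced.isUnscaledPseudoCodeword [Fintype J] [Fintype I] {p : I → ℕ}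
    (hp : IsBalanced H p) : IsUnscaledPseudoCodeword H fun i => (p i : ℚ) := by
  classical
  choose m e hm he using hp.exists_pairing
  -- Large enough to hold all `p i` and all `m j`; the added 1 keeps the degree positive when `p =
  -- 0`.
  set M := ∑ i, p i + 1 with hM
  have hpM : ∀ i, p i ≤ M := fun i =>
    (Finset.single_le_sum (fun _ _ => zero_le) (Finset.mem_univ i)).trans (Nat.le_succ _)
  have hmM : ∀ j, m j ≤ M := fun j => (hm j).trans (Nat.le_succ _)
  have hσ : ∀ i j, ∃ σ : Equiv.Perm (Fin M), ∀ (h : H j i = 1) (a : Fin (p i)),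
      σ (Fin.castLE (hpM i) a) = Fin.castLE (hmM j) (e j ⟨⟨i, h⟩, a⟩).2 := by
    intro i j
    by_cases h : H j i = 1
    · obtain ⟨σ, hσ⟩ := exists_perm_castLE (hpM i)
        (fun a => Fin.castLE (hmM j) (e j ⟨⟨i, h⟩, a⟩).2)
        (fun a b hab => he j ⟨i, h⟩ a b (Fin.castLE_injective _ hab))
      exact ⟨σ, fun _ => hσ⟩
    -- Without an edge between `i` and `j` the permutation plays no role.
    · exact ⟨1, fun h' => absurd h' h⟩
  choose σ hσ using hσ
  -- The vertices of the cover must form a `Type`, whereas `I` and `J` may live in any universe;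
  -- hence the relabelling by some `Fin n`.
  let f := (Fintype.equivFin ((I ⊕ J) × Fin M)).symm
  let χ : (I ⊕ J) × Fin M → ZMod 2 := fun x =>
    if x.2 < x.1.elim p 0 then 1 else 0
  have hχ : ∀ i k, χ (Sum.inl i, k) = if (k : ℕ) < p i then 1 else 0 := fun _ _ => rfl
  refine ⟨M, _, inferInstance, _, liftProj (H := H) f σ, Nat.succ_pos _,
    isMCover_liftProj (Nat.succ_pos _) f σ, fun b => χ (f b), ?_, ?_⟩
  · refine LinearMap.mem_ker.2 (funext fun w => ?_)
    obtain ⟨j, hj⟩ := Sum.isRight_iff.1 w.2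
    obtain ⟨t, ht⟩ : ∃ t, f w = (Sum.inr j, t) := ⟨(f w).2, Prod.ext hj rfl⟩
    rw [Matrix.mulVecLin_apply, Matrix.mulVec, dotProduct, Pi.zero_apply]
    have h1 := sum_bitNode_liftProj (H := H) f σ
      (fun x => (if (liftGraph H σ).Adj (Sum.inr j, t) x then (1 : ZMod 2) else 0) * χ x)
    have h2 : ∀ b : BitNode (liftProj (H := H) f σ), coverMatrix (liftProj (H := H) f σ) w b =
        if (liftGraph H σ).Adj (Sum.inr j, t) (f b) then (1 : ZMod 2) else 0 := fun b => by
      rw [coverMatrix, SimpleGraph.comap_adj, ht]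
    simp only [h2]
    rw [h1]
    have h3 : ∀ i, ∑ k, (if (liftGraph H σ).Adj (Sum.inr j, t) (Sum.inl i, k) then (1 : ZMod 2)
        else 0) * χ (Sum.inl i, k) =
        if h : H j i = 1 then ∑ a : Fin (p i),
          (if Fin.castLE (hmM j) (e j ⟨⟨i, h⟩, a⟩).2 = t then 1 else 0) else 0 := by
      intro i
      split_ifs with h
      · simp only [liftGraph_adj_inr_inl, h, true_and, ← hσ i j h]
        rw [← sum_ite_val_lt (hpM i) fun k => if σ i j k = t then (1 : ZMod 2) else 0]
        simp only [hχ, ite_mul, one_mul, zero_mul]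
        exact Finset.sum_congr rfl fun k _ => by split_ifs <;> rfl
      · simp [liftGraph_adj_inr_inl, h]
    simp only [h3]
    have h4 : ∀ F : (i : I) → H j i = 1 → ZMod 2,
        ∑ i, (if h : H j i = 1 then F i h else 0) = ∑ k : {i // H j i = 1}, F k k.2 := by
      intro F
      rw [← Finset.sum_filter_of_ne (p := fun i => H j i = 1)
        (fun i _ hi => by_contra fun h => hi (dif_neg h)),
        Finset.sum_subtype _ (p := fun i => H j i = 1) (by simp)]
      exact Finset.sum_congr rfl fun k _ => dif_pos k.2
    -- Reindexed along the pairing, the sum runs over two rows with identical terms, and these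
    -- cancel in characteristic 2.
    rw [h4, ← Fintype.sum_sigma' (fun (k : {i // H j i = 1}) (a : Fin (p k)) =>
      if Fin.castLE (hmM j) (e j ⟨k, a⟩).2 = t then (1 : ZMod 2) else 0),
      (e j).sum_comp (fun x => if Fin.castLE (hmM j) x.2 = t then (1 : ZMod 2) else 0),
      Fintype.sum_prod_type, Fin.sum_univ_two]
    exact CharTwo.add_self_eq_zero _
  · funext i
    rw [Pi.smul_apply, pseudoCodeword, smul_eq_mul, ← mul_assoc,
      mul_one_div_cancel (by positivity), one_mul, Finset.sum_filter]
    have h1 := sum_bitNode_liftProj (H := H) f σ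
      (fun x => if x.1 = Sum.inl i then ((χ x).val : ℚ) else 0)
    refine Eq.trans ?_ (Eq.trans h1.symm ?_)
    · rw [Finset.sum_eq_single i (fun i' _ hne => Finset.sum_eq_zero fun k _ => by simp [hne])
        (by simp)]
      have h2 := sum_ite_val_lt (hpM i) fun _ => (1 : ℚ)
      rw [Finset.sum_const, Finset.card_univ, Fintype.card_fin, nsmul_one] at h2
      rw [← h2]
      refine Finset.sum_congr rfl fun k _ => ?_
      simp only [hχ, if_true]
      split_ifs <;> simp [ZMod.val_one]
    · exact Finset.sum_congr rfl fun b _ => by congr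

end BalancedToCover

end CycleCode

/-- The product defining the edge zeta function of the normal graph of a cycle code converges, and
a monomial occurs in it exactly when its exponent vector is an unscaled pseudo-codeword. -/
theorem mainTheorem1 {J I : Type*} [Fintype J] [Fintype I] (H : Matrix J I (ZMod 2))
    (hH : CycleCode.IsCycleCode H) :
    Multipliable (fun γ : CycleCode.primeCycles (CycleCode.normalGraph H) =>
        CycleCode.eulerFactor (γ : Cycle (CycleCode.DirectedEdge (CycleCode.normalGraph H)))) ∧
      ∀ p : I →₀ ℕ,
        MvPowerSeries.coeff p (CycleCode.edgeZeta (CycleCode.normalGraph H)) ≠ 0 ↔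
          CycleCode.IsUnscaledPseudoCodeword H (fun i => (p i : ℚ)) := by
  have hne : ∀ γ : CycleCode.primeCycles (CycleCode.normalGraph H),
      CycleCode.cycleExponent (γ : Cycle (CycleCode.DirectedEdge (CycleCode.normalGraph H))) ≠ 0 :=
    fun γ => CycleCode.cycleExponent_ne_zero γ.2
  have hfin := CycleCode.finite_cycleExponent_le (G := CycleCode.normalGraph H)
  simp only [CycleCode.edgeZeta, CycleCode.eulerFactor_eq_geomSeries]
  refine ⟨CycleCode.multipliable_geomSeries hne hfin, fun p => ?_⟩
  rw [CycleCode.coeff_tprod_geomSeries_ne_zero_iff hne hfin]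
  exact ⟨fun h => (CycleCode.isBalanced_of_mem_primeExponents h).isUnscaledPseudoCodeword,
    fun h => h.isBalanced.mem_primeExponents hH⟩
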